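/- Let $p$ be a prime and let $K$ be a field of characteristic $p$ that admits a valuation $v : K \to \Gamma \cup \{\infty\}$, with $K^\times$ mapped onto a totally ordered abelian group $\Gamma$ (the value group, written additively), such that $\Gamma$ is not $p$-divisible, i.e. $p\Gamma \neq \Gamma$. Let $\mathrm{Gal}(K) = \mathrm{Gal}(K^{\mathrm{sep}}/K)$ be the absolute Galois group of $K$ with its Krull topology. Then every finite embedding problem for $\mathrm{Gal}(K)$ whose kernel is a $p$-group has a proper solution: for all profinite groups $B$ and $A$ with $B$ finite, and all continuous surjective homomorphisms $\alpha : \mathrm{Gal}(K) \to A$ and $f : B \to A$ such that $\ker f$ is a $p$-group, there is a continuous surjective homomorphism $\beta : \mathrm{Gal}(K) \to B$ with $f \circ \beta = \alpha$. -/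

import Mathlib

universe u v w x

/-- The absolute Galois group `Gal(K) = Gal(Kˢᵉᵖ / K)` of a field `K`; as a Galois group
it carries the Krull topology. -/
abbrev AbsGal (K : Type u) [Field K] : Type u :=
  SeparableClosure K ≃ₐ[K] SeparableClosure K

/-- An additively written commutative group `Γ` is `p`-divisible if `Γ = pΓ`. -/
def IsPDivisible (p : ℕ) (Γ : Type u) [AddCommGroup Γ] : Prop :=
  ∀ γ : Γ, ∃ δ : Γ, p • δ = γ

/-- An embedding problem for a (profinite) group `P`: profinite groups `B` and `A`, and
continuous epimorphisms `α : P → A` and `f : B → A`. -/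
structure EmbeddingProblem (P : Type u) [Group P] [TopologicalSpace P] where
  B : ProfiniteGrp.{v}
  A : ProfiniteGrp.{w}
  α : P →ₜ* A
  f : B →ₜ* A
  surjective_α : Function.Surjective α
  surjective_f : Function.Surjective f

namespace EmbeddingProblem

variable {P : Type u} [Group P] [TopologicalSpace P]

/-- The kernel of the embedding problem. -/
def kernel (E : EmbeddingProblem.{u, v, w} P) : Subgroup E.B :=
  E.f.toMonoidHom.ker

/-- The embedding problem is finite if `B` (hence also `A`) is finite. -/
def IsFinite (E : EmbeddingProblem.{u, v, w} P) : Prop :=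
  Finite E.B

/-- A `p`-embedding problem: the kernel is a `p`-group. -/
def IsPEmbeddingProblem (p : ℕ) (E : EmbeddingProblem.{u, v, w} P) : Prop :=
  IsPGroup p E.kernel

/-- A weak solution: a continuous homomorphism `β : P → B` with `f ∘ β = α`. -/
def IsWeakSolution (E : EmbeddingProblem.{u, v, w} P) (β : P →ₜ* E.B) : Prop :=
  E.f.comp β = E.α

/-- A proper solution: a surjective weak solution. -/
def IsProperSolution (E : EmbeddingProblem.{u, v, w} P) (β : P →ₜ* E.B) : Prop :=
  E.IsWeakSolution β ∧ Function.Surjective β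

/-- The embedding problem is properly solvable. -/
def IsProperlySolvable (E : EmbeddingProblem.{u, v, w} P) : Prop :=
  ∃ β : P →ₜ* E.B, E.IsProperSolution β

end EmbeddingProblem

/-!
Successive quotients by minimal normal subgroups reduce the problem to an epimorphism `B → A` of
finite groups whose kernel `M` is a minimal normal `p`-subgroup of `B`, hence a vector space over the
prime field on which `A` acts by conjugation. Let `L` be the fixed field of the kernel of
`α : Gal(K) → A`.

Let `κ` be the factor set of `B` over `A`. With an element of trace one in `L`, `κ` becomes the
coboundary of an explicit cochain `l` with values in `M ⊗ L`. The Artin–Schreier operator `℘` kills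
`M`, so `℘ l` is a cocycle, and, again by the trace, it comes from some `y` in `M ⊗ L`. Solving
`℘ z = y` over the separable closure and correcting `l` by the coboundary of `z` gives a cochain with
values in `ker ℘ = M` that splits the pulled-back factor set: a weak solution
(`exists_cochain_splitting`).

A weak solution is surjective unless it is trivial on `Gal(L)`, by minimality of `M`, and it is
trivial there only if all coordinates of `z` lie in `L`. Now `y` may be changed by any element of
`(M ⊗ L)^A`, a non-zero `K`-subspace (independence of characters), so it suffices that `℘ L` contains
no line `K • c` with `c ≠ 0`. This is where the valuation enters
(`exists_forall_pow_sub_ne_smul`): in terms of a basis `e` of `L` and the basis `e ^ p`, available as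
`L` is separable over `K`, the equation `w ^ p - w = a • c` says that each coordinate of `a • c` is a
`p`-th power up to an error that is dominated when `a` has very negative valuation, so that the
valuation of `a` would be confined to one coset of `pΓ`.

The module `M ⊗ F` is realized as `Hom(M*, F)`, with `M*` the dual over the prime field.
-/

/-! ### Artin–Schreier classes over a field with a valuation -/

section Valuation

variable {Γ : Type*} [AddCommGroup Γ] [LinearOrder Γ] [IsOrderedAddMonoid Γ]

/-- A coset of `pΓ` other than `pΓ` itself has elements below any bound. -/
lemma exists_lt_forall_nsmul_ne {p : ℕ} [hp : Fact p.Prime] (hΓ : ¬ IsPDivisible p Γ)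
    (C D : Γ) : ∃ α < D, ∀ δ, p • δ ≠ α + C := by
  simp only [IsPDivisible, not_forall, not_exists] at hΓ
  obtain ⟨γ, hγ⟩ := hΓ
  have hγ0 : γ ≠ 0 := fun h => hγ 0 (by rw [h, smul_zero])
  have habs : 0 < |γ| := abs_pos.2 hγ0
  have h1 : D - γ + C ≤ |D - γ + C| := le_abs_self _
  have h2 : -(D - γ + C) ≤ |D - γ + C| := neg_le_abs _
  set T := |D - γ + C| + |γ| with hT
  have hT0 : 0 ≤ T := by positivity
  have hpT : T ≤ p • T := le_self_nsmul hT0 hp.out.ne_zero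
  refine ⟨γ - C - p • T, by grind, fun δ hδ => hγ (δ + T) ?_⟩
  rw [smul_add, hδ]
  abel

/-- Suppose `w ^ p - w = a • c`, let `α` be the valuation of `a`, `C` that of some coordinate of `c`,
`μ` the least valuation of a coordinate of `w`, and `κ` a lower bound for the valuations of the
structure constants and of the coordinates of `c`. Then `h` holds, and it excludes `hμ` as soon as
`α` is negative enough. -/
lemma false_of_valuation_bounds {p : ℕ} (hp : 2 ≤ p) {κ C α μ : Γ} (hκ : κ ≤ 0)
    (hα0 : α < 0) (hα1 : α < κ + κ - C) (hα2 : α < κ - p • (C - κ)) (hμ : μ + κ ≤ α + C)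
    (h : α + κ ≤ p • μ ∨ μ + κ ≤ p • μ) : False := by
  have key : ∀ x : Γ, x ≤ 0 → p • x ≤ x + x := fun x hx => by
    obtain ⟨k, rfl⟩ := Nat.exists_eq_add_of_le hp
    have : k • x ≤ 0 := nsmul_nonpos hx k
    rw [add_smul, two_nsmul]
    grind
  rcases h with h | h
  · have h1 : p • μ ≤ p • (α + (C - κ)) := nsmul_le_nsmul_right (by grind) p
    have h2 := key α hα0.le
    rw [smul_add] at h1
    grind
  · by_cases hμκ : κ ≤ μ
    · grind
    · have := key μ (by grind)
      grind

/-- Over a separable extension `L` of a field `K` of characteristic `p` whose value group is not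
`p`-divisible, no `K`-line of `L` consists of values of `w ↦ w ^ p - w`. The valuation of `K` is not
extended to `L`: as `L` is separable over `K`, the `p`-th powers of a basis of `L` again form a
basis, in which the coordinates of `w ^ p` are `p`-th powers in `K`. A coordinate of `a • c` whose
valuation is very negative and outside `pΓ` then cannot be matched. -/
theorem exists_forall_pow_sub_ne_smul {p : ℕ} [hp : Fact p.Prime] {K : Type*} [Field K] [CharP K p]
    (val : AddValuation K (WithTop Γ)) (hval : Function.Surjective val)
    (hΓ : ¬ IsPDivisible p Γ) {L : Type*} [Field L] [Algebra K L] [FiniteDimensional K L]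
    [Algebra.IsSeparable K L] {c : L} (hc : c ≠ 0) :
    ∃ a : K, ∀ w : L, w ^ p - w ≠ a • c := by
  have : ExpChar K p := ExpChar.prime hp.out
  have : CharP L p := charP_of_injective_algebraMap (algebraMap K L).injective p
  let e := Module.finBasis K L
  let e' := e.mapPowExpCharPowOfIsSeparable p 1
  have he' (i) : e' i = e i ^ p := by
    simp [e', Module.Basis.mapPowExpCharPowOfIsSeparable]
  obtain ⟨j, hj⟩ : ∃ j, e'.repr c j ≠ 0 := by
    by_contra! h
    exact hc (e'.repr.map_eq_zero_iff.1 (Finsupp.ext h))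
  have hfin (x : K) (hx : x ≠ 0) : ∃ γ : Γ, val x = γ :=
    ⟨_, (WithTop.coe_untop _ ((AddValuation.ne_top_iff val).2 hx)).symm⟩
  have hbound (x : K) : ∃ γ : Γ, (γ : WithTop Γ) ≤ val x := by
    by_cases hx : x = 0
    · exact ⟨0, by simp [hx]⟩
    · obtain ⟨γ, h⟩ := hfin x hx
      exact ⟨γ, h.ge⟩
  obtain ⟨C, hC⟩ := hfin _ hj
  choose m hm using fun i j => hbound (e'.repr (e i) j)
  choose n hn using fun j => hbound (e'.repr c j)
  obtain ⟨κ, hκ⟩ : ∃ κ : Γ, ∀ x ∈ insert 0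
      (Set.range (fun q : _ × _ => m q.1 q.2) ∪ Set.range n), κ ≤ x := by
    have : (insert 0
      (Set.range (fun q : _ × _ => m q.1 q.2) ∪ Set.range n)).Finite := Set.toFinite _
    exact this.bddBelow
  have hκ0 : κ ≤ 0 := hκ _ (by simp)
  have hκm (i j) : (κ : WithTop Γ) ≤ val (e'.repr (e i) j) :=
    (WithTop.coe_le_coe.2 (hκ _ (by simp))).trans (hm i j)
  have hκn (j) : (κ : WithTop Γ) ≤ val (e'.repr c j) :=
    (WithTop.coe_le_coe.2 (hκ _ (by simp))).trans (hn j)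
  obtain ⟨α, hα, hαC⟩ := exists_lt_forall_nsmul_ne (p := p) hΓ C
    (min 0 (min (κ + κ - C) (κ - p • (C - κ))))
  simp only [lt_min_iff] at hα
  obtain ⟨a, ha⟩ := hval α
  refine ⟨a, fun w hw => ?_⟩
  -- The `k`-th coordinate of the equation, with respect to the basis of `p`-th powers.
  have hcoord (k) : a * e'.repr c k =
      e.repr w k ^ p - ∑ i, e.repr w i * e'.repr (e i) k := by
    have h1 : e'.repr (w ^ p) k = e.repr w k ^ p := by
      have : w ^ p = ∑ i, e.repr w i ^ p • e' i := by
        conv_lhs => rw [← e.sum_repr w, sum_pow_char]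
        simp [he', smul_pow]
      rw [this, e'.repr_sum_self]
    have h2 : e'.repr w k = ∑ i, e.repr w i * e'.repr (e i) k := by
      conv_lhs => rw [← e.sum_repr w]
      rw [map_sum, Finsupp.finsetSum_apply]
      simp only [map_smul, Finsupp.smul_apply, smul_eq_mul]
    rw [← h1, ← h2, ← smul_eq_mul, ← Finsupp.smul_apply, ← map_smul, ← hw, map_sub,
      Finsupp.sub_apply]
  obtain ⟨i₀, -, hi₀⟩ := Finset.exists_min_image Finset.univ (fun i => val (e.repr w i))
    ⟨j, by simp⟩
  have hr (k) : val (e.repr w i₀) + κ ≤ val (∑ i, e.repr w i * e'.repr (e i) k) :=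
    AddValuation.map_le_sum val fun i _ => by
      rw [AddValuation.map_mul]
      exact add_le_add (hi₀ i (by simp)) (hκm i k)
  -- Otherwise `w_j ^ p` is the leading term in the `j`-th coordinate, and `α + C` lies in `pΓ`.
  have hle : val (e.repr w i₀) + κ ≤ ((α + C : Γ) : WithTop Γ) := by
    by_contra! hlt
    have hvj : val (a * e'.repr c j) = ((α + C : Γ) : WithTop Γ) := by
      rw [AddValuation.map_mul, ha, hC, WithTop.coe_add]
    have hpow : val (e.repr w j ^ p) = ((α + C : Γ) : WithTop Γ) := by
      have : e.repr w j ^ p = a * e'.repr c j + ∑ i, e.repr w i * e'.repr (e i) j := by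
        rw [hcoord j]; ring
      rw [this, ← hvj]
      exact AddValuation.map_add_eq_of_lt_left val (by
        rw [hvj]; exact hlt.trans_le (hr j))
    obtain ⟨δ, hδ⟩ := hfin (e.repr w j) (by
      intro h
      rw [h, zero_pow hp.out.ne_zero, AddValuation.map_zero] at hpow
      exact WithTop.top_ne_coe hpow)
    rw [AddValuation.map_pow, hδ, ← WithTop.coe_nsmul, WithTop.coe_inj] at hpow
    exact hαC δ hpow
  obtain ⟨μ, hμ⟩ := hfin (e.repr w i₀) (by
    intro h
    simp [h] at hle)
  -- The coordinate `i₀`, where `w` has its least valuation `μ`, bounds `p • μ` from below.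
  have hmin : (α : WithTop Γ) + κ ≤ val (e.repr w i₀ ^ p) ∨
      (μ : WithTop Γ) + κ ≤ val (e.repr w i₀ ^ p) := by
    have : e.repr w i₀ ^ p =
        a * e'.repr c i₀ + ∑ i, e.repr w i * e'.repr (e i) i₀ := by
      rw [hcoord i₀]; ring
    rw [this]
    refine (AddValuation.map_add' val _ _).imp (fun h => le_trans ?_ h) (fun h => le_trans ?_ h)
    · rw [AddValuation.map_mul, ha]
      exact add_le_add le_rfl (hκn i₀)
    · rw [← hμ]; exact hr i₀
  rw [AddValuation.map_pow, hμ] at hmin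
  rw [hμ] at hle
  norm_cast at hmin hle
  exact false_of_valuation_bounds hp.out.two_le hκ0 hα.1 hα.2.1 hα.2.2 hle hmin

end Valuation

/-! ### The Artin–Schreier operator -/

section ArtinSchreier

lemma eq_of_forall_algebraMap_dual_eq (p : ℕ) [Fact p.Prime] {F : Type*} [Field F]
    [Algebra (ZMod p) F] {M : Type*} [AddCommGroup M] [Module (ZMod p) M]
    {m m' : M} (h : ∀ χ : Module.Dual (ZMod p) M,
      algebraMap (ZMod p) F (χ m) = algebraMap (ZMod p) F (χ m')) : m = m' := by
  rw [← sub_eq_zero, ← Module.forall_dual_apply_eq_zero_iff (ZMod p)]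
  intro χ
  rw [map_sub, (algebraMap (ZMod p) F).injective (h χ), sub_self]

variable (p : ℕ) [hp : Fact p.Prime] (F : Type*) [Field F] [CharP F p] [Algebra (ZMod p) F]

/-- The Artin–Schreier operator `x ↦ x ^ p - x`, as a linear map over the prime field. -/
def artinSchreier : F →ₗ[ZMod p] F :=
  ((frobenius F p : F →+ F) - AddMonoidHom.id F).toZModLinearMap p

variable {F}

@[simp]
lemma artinSchreier_apply (x : F) : artinSchreier p F x = x ^ p - x := rfl

lemma artinSchreier_algEquiv {K : Type*} [Field K] [Algebra K F] (g : F ≃ₐ[K] F) (x : F) :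
    artinSchreier p F (g x) = g (artinSchreier p F x) := by
  simp

lemma artinSchreier_surjective [IsSepClosed F] : Function.Surjective (artinSchreier p F) := by
  intro a
  let f : Polynomial F := .X ^ p - .X - .C a
  have hder : f.derivative = -1 := by
    simp [f, Polynomial.derivative_X_pow]
  have hsep : f.Separable := by
    rw [Polynomial.Separable, hder]
    exact isCoprime_one_right.neg_right
  have hdeg : f.degree ≠ 0 := by
    have : f.degree = p := by
      have h : ((.X : Polynomial F) + .C a).degree < ((.X : Polynomial F) ^ p).degree := by
        rw [Polynomial.degree_X_add_C, Polynomial.degree_X_pow]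
        exact_mod_cast hp.out.one_lt
      rw [show f = .X ^ p - (.X + .C a) by simp only [f]; ring,
        Polynomial.degree_sub_eq_left_of_degree_lt h, Polynomial.degree_X_pow]
    rw [this]
    exact_mod_cast hp.out.ne_zero
  obtain ⟨x, hx⟩ := IsSepClosed.exists_root f hdeg hsep
  refine ⟨x, ?_⟩
  simpa [f, sub_eq_zero] using hx

lemma mem_range_algebraMap_of_artinSchreier_eq_zero {x : F} (hx : artinSchreier p F x = 0) :
    x ∈ Set.range (algebraMap (ZMod p) F) := by
  have h : x ∈ (⊥ : Subfield F) :=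
    (Subfield.mem_bot_iff_pow_eq_self F p).2 (sub_eq_zero.1 hx)
  exact (bot_le (a := (algebraMap (ZMod p) F).fieldRange)) h

/-- The kernel of the Artin–Schreier operator on `M ⊗ F = Hom(M*, F)` is `M`. -/
lemma exists_algebraMap_dual_eq {M : Type*} [AddCommGroup M] [Module (ZMod p) M]
    [Module.Finite (ZMod p) M] (w : Module.Dual (ZMod p) M →ₗ[ZMod p] F)
    (hw : ∀ χ, artinSchreier p F (w χ) = 0) :
    ∃ m : M, ∀ χ : Module.Dual (ZMod p) M, algebraMap (ZMod p) F (χ m) = w χ := by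
  let i := Algebra.linearMap (ZMod p) F
  have hi : Function.Injective i := (algebraMap (ZMod p) F).injective
  let w' : Module.Dual (ZMod p) M →ₗ[ZMod p] LinearMap.range i :=
    w.codRestrict _ fun χ => mem_range_algebraMap_of_artinSchreier_eq_zero p (hw χ)
  let u : Module.Dual (ZMod p) (Module.Dual (ZMod p) M) :=
    (LinearEquiv.ofInjective i hi).symm.toLinearMap ∘ₗ w'
  obtain ⟨m, hm⟩ := (Module.evalEquiv (ZMod p) M).surjective u
  refine ⟨m, fun χ => ?_⟩
  have h1 : χ m = u χ := by rw [← hm]; rfl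
  have h2 : LinearEquiv.ofInjective i hi (u χ) = w' χ := by simp [u]
  rw [h1]
  exact congrArg Subtype.val h2

end ArtinSchreier

/-! ### Families of conjugates -/

section Conjugates

open IntermediateField

variable {K F : Type*} [Field K] [Field F] [Algebra K F] [IsGalois K F]
  {A : Type*} [Group A] {α : (F ≃ₐ[K] F) →* A}

/-- The conjugates over `K` of a suitable element of the fixed field of `ker α` have a non-zero
linear combination with prescribed coefficients, by independence of characters. -/
lemma exists_conjugates_sum_mul_ne_zero [Fintype A] (hα : Function.Surjective α)
    (hopen : IsOpen (α.ker : Set (F ≃ₐ[K] F))) {a : A → F} (ha : a ≠ 0) :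
    ∃ t : A → F, (∀ g τ, g (t τ) = t (α g * τ)) ∧ ∑ τ, a τ * t τ ≠ 0 := by
  let s := Function.surjInv hα
  have hs : ∀ τ, α (s τ) = τ := Function.surjInv_eq hα
  let L := fixedField α.ker
  have hL : L.fixingSubgroup = α.ker :=
    InfiniteGalois.fixingSubgroup_fixedField
      ⟨α.ker, Subgroup.isClosed_of_isOpen _ hopen⟩
  let c (τ : A) : L →* F := ((s τ : F →* F)).comp (L.val : L →* F)
  have hc : Function.Injective c := by
    intro τ τ' h
    have : (s τ)⁻¹ * s τ' ∈ L.fixingSubgroup := by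
      rw [IntermediateField.mem_fixingSubgroup_iff]
      intro x hx
      have h1 : s τ x = s τ' x := DFunLike.congr_fun h ⟨x, hx⟩
      rw [AlgEquiv.mul_apply, ← h1]
      exact (s τ).symm_apply_apply x
    rw [hL, MonoidHom.mem_ker, map_mul, map_inv, hs, hs, inv_mul_eq_one] at this
    exact this
  obtain ⟨l, hl⟩ : ∃ l : L, ∑ τ, a τ * c τ l ≠ 0 := by
    by_contra! h
    refine ha (funext fun τ => ?_)
    refine Fintype.linearIndependent_iff.1
      ((linearIndependent_monoidHom L F).comp c hc) a (funext fun l => ?_) τ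
    simpa [Finset.sum_apply] using h l
  refine ⟨fun τ => s τ l, fun g τ => ?_, hl⟩
  have hmem : (s (α g * τ))⁻¹ * (g * s τ) ∈ α.ker := by simp [hs]
  have := l.2 ⟨_, hmem⟩
  calc g (s τ l) = s (α g * τ) (((s (α g * τ))⁻¹ * (g * s τ)) l) := by
        rw [← AlgEquiv.mul_apply, ← AlgEquiv.mul_apply, mul_inv_cancel_left]
    _ = _ := congrArg _ this

lemma exists_conjugates_sum_eq_one [Fintype A] (hα : Function.Surjective α)
    (hopen : IsOpen (α.ker : Set (F ≃ₐ[K] F))) :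
    ∃ t : A → F, (∀ g τ, g (t τ) = t (α g * τ)) ∧ ∑ τ, t τ = 1 := by
  obtain ⟨t, ht, h0⟩ := exists_conjugates_sum_mul_ne_zero hα hopen (a := fun _ => 1)
    (fun h => one_ne_zero (congrFun h 1))
  simp only [one_mul] at h0
  have hfix (g : F ≃ₐ[K] F) : g (∑ τ, t τ) = ∑ τ, t τ := by
    rw [map_sum]
    simp only [ht]
    exact Fintype.sum_equiv (Equiv.mulLeft (α g)) _ _ fun _ => rfl
  refine ⟨fun τ => t τ / ∑ υ, t υ, fun g τ => ?_, ?_⟩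
  · rw [map_div₀, hfix, ht]
  · rw [← Finset.sum_div, div_self h0]

end Conjugates

/-! ### Trivializing the pulled-back factor set -/

section Cochain

open IntermediateField Module

variable {p : ℕ} [hp : Fact p.Prime] {K F : Type*} [Field K] [Field F] [Algebra K F]
  [Algebra (ZMod p) F] {M : Type*} [AddCommGroup M] [Module (ZMod p) M]

/-- The pure tensor `m ⊗ x` in `M ⊗ F = Hom(M*, F)`. -/
def dualTensor (m : M) (x : F) : Dual (ZMod p) M →ₗ[ZMod p] F :=
  (Dual.eval (ZMod p) M m).smulRight x

lemma dualTensor_apply (m : M) (x : F) (χ : Dual (ZMod p) M) :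
    dualTensor m x χ = algebraMap (ZMod p) F (χ m) * x := by
  simp [dualTensor, Algebra.smul_def]

lemma algEquiv_algebraMap_zmod (g : F ≃ₐ[K] F) (c : ZMod p) :
    g (algebraMap (ZMod p) F c) = algebraMap (ZMod p) F c := by
  have : (g : F →+* F).comp (algebraMap (ZMod p) F) = algebraMap (ZMod p) F :=
    Subsingleton.elim _ _
  exact DFunLike.congr_fun this c

/-- The Galois group acts on `M ⊗ F = Hom(M*, F)` through `α` on `M` and naturally on `F`; at a
functional `χ`, the action of `g` is `w ↦ g (w (χ ∘ ρ (α g)))`. A factor set `κ` of `A` in `M`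
becomes a coboundary in `M ⊗ F`, and its splitting, corrected by an Artin–Schreier root `z` of an
element `y` of `M ⊗ F`, takes values in `M`. The element `y` can be changed by any invariant of
`M ⊗ F`, and the hypothesis `hline` gives an invariant for which a coordinate of `z` is not fixed by
`ker α`. -/
theorem exists_cochain_splitting [IsGalois K F] [IsSepClosed F] [CharP F p] [Finite M]
    [Nontrivial M] {A : Type*} [Group A] [Finite A] {α : (F ≃ₐ[K] F) →* A}
    (hα : Function.Surjective α)
    (hopen : IsOpen (α.ker : Set (F ≃ₐ[K] F)))
    (hline : ∀ c ∈ fixedField α.ker, c ≠ 0 →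
      ∃ a : K, ∀ w ∈ fixedField α.ker, artinSchreier p F w ≠ a • c)
    (ρ : Representation (ZMod p) A M) (κ : A → A → M)
    (hκ : ∀ σ τ υ, κ σ τ + κ (σ * τ) υ = ρ σ (κ τ υ) + κ σ (τ * υ)) :
    ∃ b : (F ≃ₐ[K] F) → M,
      (∀ g h, b (g * h) = b g + ρ (α g) (b h) + κ (α g) (α h)) ∧
      (∃ g ∈ α.ker, b g ≠ b 1) ∧
      ∃ U : Subgroup (F ≃ₐ[K] F), IsOpen (U : Set (F ≃ₐ[K] F)) ∧ ∀ g ∈ U, b g = b 1 := by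
  have := Fintype.ofFinite A
  have hgK (g : F ≃ₐ[K] F) (c : ZMod p) := algEquiv_algebraMap_zmod (K := K) g c
  obtain ⟨t, ht, ht1⟩ := exists_conjugates_sum_eq_one hα hopen
  -- `κ` is the coboundary of `l`, since `t` has sum one.
  let l (σ : A) : Dual (ZMod p) M →ₗ[ZMod p] F := ∑ τ, dualTensor (κ σ τ) (t (σ * τ))
  have hl (g : F ≃ₐ[K] F) (τ : A) (χ : Dual (ZMod p) M) :
      g (l τ (χ ∘ₗ ρ (α g))) =
      algebraMap (ZMod p) F (χ (κ (α g) τ)) + l (α g * τ) χ - l (α g) χ := by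
    have h1 : l (α g) χ = ∑ υ, dualTensor (κ (α g) (τ * υ)) (t (α g * τ * υ)) χ := by
      simp only [l, LinearMap.sum_apply]
      refine (Fintype.sum_equiv (Equiv.mulLeft τ) _ _ fun υ => ?_).symm
      simp [mul_assoc]
    have h2 : algebraMap (ZMod p) F (χ (κ (α g) τ)) =
        ∑ υ, algebraMap (ZMod p) F (χ (κ (α g) τ)) * t (α g * τ * υ) := by
      rw [← Finset.mul_sum, Fintype.sum_equiv (Equiv.mulLeft (α g * τ)) (fun υ => t (α g * τ * υ))
        t (fun _ => rfl), ht1, mul_one]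
    rw [h1, h2]
    simp only [l, LinearMap.sum_apply, map_sum, ← Finset.sum_add_distrib,
      ← Finset.sum_sub_distrib, dualTensor_apply, map_mul, hgK, ht, LinearMap.comp_apply]
    refine Finset.sum_congr rfl fun υ _ => ?_
    have := congrArg (fun m => algebraMap (ZMod p) F (χ m)) (hκ (α g) τ υ)
    simp only [map_add] at this
    rw [← mul_assoc (α g)]
    linear_combination (-t (α g * τ * υ)) * this
  -- The Artin–Schreier operator turns `l` into a 1-cocycle, which is the coboundary of `x`.
  let x : Dual (ZMod p) M →ₗ[ZMod p] F :=
    ∑ τ, LinearMap.mulLeft (ZMod p) (t τ) ∘ₗ artinSchreier p F ∘ₗ l τ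
  have hx (g : F ≃ₐ[K] F) (χ : Dual (ZMod p) M) :
      g (x (χ ∘ₗ ρ (α g))) = x χ - artinSchreier p F (l (α g) χ) := by
    have h1 : artinSchreier p F (l (α g) χ) =
        ∑ τ, t (α g * τ) * artinSchreier p F (l (α g) χ) := by
      rw [← Finset.sum_mul, Fintype.sum_equiv (Equiv.mulLeft (α g)) (fun υ => t (α g * υ))
        t (fun _ => rfl), ht1, one_mul]
    have h2 : x χ = ∑ τ, t (α g * τ) * artinSchreier p F (l (α g * τ) χ) := by
      simp only [x, LinearMap.sum_apply, LinearMap.comp_apply, LinearMap.mulLeft_apply]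
      exact (Fintype.sum_equiv (Equiv.mulLeft (α g)) _ _ fun υ => rfl).symm
    have h3 (c : ZMod p) : artinSchreier p F (algebraMap (ZMod p) F c) = 0 := by
      rw [artinSchreier_apply, ← map_pow, ZMod.pow_card, sub_self]
    rw [h1, h2]
    simp only [x, LinearMap.sum_apply, map_sum, ← Finset.sum_sub_distrib, LinearMap.comp_apply,
      LinearMap.mulLeft_apply, map_mul, ht, ← artinSchreier_algEquiv]
    refine Finset.sum_congr rfl fun τ _ => ?_
    rw [hl, map_sub, map_add, h3]
    ring
  obtain ⟨n, hn⟩ := exists_ne (0 : M)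
  obtain ⟨χ₀, hχ₀⟩ : ∃ χ : Dual (ZMod p) M, χ n ≠ 0 := by
    by_contra! h
    exact hn ((forall_dual_apply_eq_zero_iff (ZMod p) n).1 h)
  obtain ⟨t', ht', hne⟩ := exists_conjugates_sum_mul_ne_zero hα hopen
    (a := fun τ => algebraMap (ZMod p) F (χ₀ (ρ τ n))) (fun h => hχ₀ (by
      simpa using congrFun h 1))
  -- An invariant of `M ⊗ F` whose coordinate at `χ₀` does not vanish.
  let v : Dual (ZMod p) M →ₗ[ZMod p] F := ∑ τ, dualTensor (ρ τ n) (t' τ)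
  have hv (g : F ≃ₐ[K] F) (χ : Dual (ZMod p) M) : g (v (χ ∘ₗ ρ (α g))) = v χ := by
    simp only [v, LinearMap.sum_apply, map_sum, dualTensor_apply, map_mul, hgK, ht',
      LinearMap.comp_apply]
    refine Fintype.sum_equiv (Equiv.mulLeft (α g)) _ _ fun υ => ?_
    simp [map_mul]
  have hker {g : F ≃ₐ[K] F} (hg : g ∈ α.ker) (χ : Dual (ZMod p) M) : χ ∘ₗ ρ (α g) = χ := by
    rw [MonoidHom.mem_ker.1 hg, map_one]; rfl
  have hv0 : v χ₀ ≠ 0 := by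
    simpa only [v, LinearMap.sum_apply, dualTensor_apply] using hne
  have hvL : v χ₀ ∈ fixedField α.ker := fun ⟨g, hg⟩ => by
    have := hv g χ₀
    rwa [hker hg] at this
  obtain ⟨a, ha⟩ : ∃ a : K, ∀ w ∈ fixedField α.ker,
      artinSchreier p F w ≠ x χ₀ + algebraMap K F a * v χ₀ := by
    by_contra! h
    obtain ⟨a, ha⟩ := hline _ hvL hv0
    obtain ⟨w, hw, h1⟩ := h a
    obtain ⟨w', hw', h2⟩ := h 0
    refine ha (w - w') (sub_mem hw hw') ?_
    rw [map_sub, h1, h2, map_zero, Algebra.smul_def]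
    ring
  let y : Dual (ZMod p) M →ₗ[ZMod p] F := x + LinearMap.mulLeft (ZMod p) (algebraMap K F a) ∘ₗ v
  have hy' (χ) : y χ = x χ + algebraMap K F a * v χ := rfl
  have hy (g : F ≃ₐ[K] F) (χ : Dual (ZMod p) M) :
      g (y (χ ∘ₗ ρ (α g))) = y χ - artinSchreier p F (l (α g) χ) := by
    rw [hy', hy', map_add, map_mul, hx, hv, AlgEquiv.commutes]
    ring
  obtain ⟨r, hr⟩ := (artinSchreier p F).exists_rightInverse_of_surjective
    (LinearMap.range_eq_top.2 (artinSchreier_surjective p))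
  let z : Dual (ZMod p) M →ₗ[ZMod p] F := r ∘ₗ y
  have hz (χ) : artinSchreier p F (z χ) = y χ := DFunLike.congr_fun hr (y χ)
  have hb (g : F ≃ₐ[K] F) : ∃ m : M, ∀ χ : Dual (ZMod p) M,
      algebraMap (ZMod p) F (χ m) = z χ - g (z (χ ∘ₗ ρ (α g))) - l (α g) χ := by
    let w : Dual (ZMod p) M →ₗ[ZMod p] F :=
      z - ((g : F →+ F).toZModLinearMap p) ∘ₗ z ∘ₗ (ρ (α g)).dualMap - l (α g)
    refine exists_algebraMap_dual_eq p w fun χ => ?_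
    have : w χ = z χ - g (z (χ ∘ₗ ρ (α g))) - l (α g) χ := rfl
    rw [this, map_sub, map_sub, artinSchreier_algEquiv, hz, hz, hy]
    ring
  choose b hb using hb
  refine ⟨b, fun g h => ?_, ?_, ?_⟩
  · refine eq_of_forall_algebraMap_dual_eq p (F := F) fun χ => ?_
    have h1 : algebraMap (ZMod p) F (χ (ρ (α g) (b h))) =
        g (algebraMap (ZMod p) F ((χ ∘ₗ ρ (α g)) (b h))) := by rw [hgK]; rfl
    have h2 : χ ∘ₗ ρ (α g * α h) = (χ ∘ₗ ρ (α g)) ∘ₗ ρ (α h) := by rw [map_mul]; rfl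
    rw [map_add, map_add, map_add, map_add, h1, hb, hb, hb, map_sub, map_sub, hl, map_mul, h2,
      AlgEquiv.mul_apply]
    ring
  · by_contra! h
    refine ha (z χ₀) (fun ⟨g, hg⟩ => ?_) (hz χ₀)
    have h1 := hb g χ₀
    rw [h g hg, hb, hker hg, hker (one_mem _), MonoidHom.mem_ker.1 hg, map_one] at h1
    have h2 : (1 : F ≃ₐ[K] F) (z χ₀) = z χ₀ := rfl
    rw [h2] at h1
    change g (z χ₀) = z χ₀
    linear_combination h1
  · have : Finite (Dual (ZMod p) M) := Module.finite_of_finite (ZMod p)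
    let R := adjoin K (Set.range z)
    have : FiniteDimensional K R := finiteDimensional_adjoin
      fun x _ => Algebra.IsIntegral.isIntegral x
    refine ⟨α.ker ⊓ R.fixingSubgroup, hopen.inter R.fixingSubgroup_isOpen, fun g hg => ?_⟩
    refine eq_of_forall_algebraMap_dual_eq p (F := F) fun χ => ?_
    have hgz : g (z χ) = z χ :=
      (IntermediateField.mem_fixingSubgroup_iff _ _).1 hg.2 _ (subset_adjoin K _ ⟨χ, rfl⟩)
    have h2 : (1 : F ≃ₐ[K] F) (z χ) = z χ := rfl
    rw [hb, hb, hker hg.1, hker (one_mem _), MonoidHom.mem_ker.1 hg.1, map_one, h2, hgz]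

end Cochain

/-! ### Minimal normal `p`-subgroups -/

section MinimalNormal

variable {p : ℕ} [hp : Fact p.Prime] {B : Type*} [Group B] [Finite B] {N : Subgroup B} [N.Normal]

/-- A minimal normal subgroup that is a `p`-group is commutative: its centre is non-trivial. -/
lemma mul_comm_of_minimal_normal (hN : IsPGroup p N) (hne : N ≠ ⊥)
    (hmin : ∀ T : Subgroup B, T.Normal → T ≤ N → T ≠ ⊥ → N ≤ T) (x y : N) : x * y = y * x := by
  have := (Subgroup.nontrivial_iff_ne_bot N).2 hne
  have := hN.center_nontrivial
  have hle : N ≤ (Subgroup.center N).map N.subtype := by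
    refine hmin _ inferInstance (Subgroup.map_subtype_le _) fun h => ?_
    rw [Subgroup.map_eq_bot_iff_of_injective _ N.subtype_injective] at h
    exact (Subgroup.nontrivial_iff_ne_bot _).1 this h
  obtain ⟨z, hz, hzx⟩ := hle x.2
  obtain rfl : z = x := N.subtype_injective hzx
  exact (Subgroup.mem_center_iff.1 hz y).symm

/-- A minimal normal subgroup that is a `p`-group has exponent `p`. -/
lemma pow_eq_one_of_minimal_normal (hN : IsPGroup p N) (hne : N ≠ ⊥)
    (hmin : ∀ T : Subgroup B, T.Normal → T ≤ N → T ≠ ⊥ → N ≤ T) (x : N) : x ^ p = 1 := by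
  have := (Subgroup.nontrivial_iff_ne_bot N).2 hne
  have hcomm := mul_comm_of_minimal_normal hN hne hmin
  let T : Subgroup B :=
    { carrier := {b | b ∈ N ∧ b ^ p = 1}
      one_mem' := ⟨one_mem _, one_pow _⟩
      mul_mem' := fun {a b} ha hb => ⟨mul_mem ha.1 hb.1, by
        have : Commute a b := congrArg Subtype.val (hcomm ⟨a, ha.1⟩ ⟨b, hb.1⟩)
        rw [this.mul_pow, ha.2, hb.2, one_mul]⟩
      inv_mem' := fun {a} ha => ⟨inv_mem ha.1, by rw [inv_pow, ha.2, inv_one]⟩ }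
  have hT : T.Normal := ⟨fun n hn g => ⟨Subgroup.Normal.conj_mem inferInstance n hn.1 g, by
    rw [conj_pow, hn.2, mul_one, mul_inv_cancel]⟩⟩
  have hT0 : T ≠ ⊥ := by
    obtain ⟨k, hk⟩ := IsPGroup.iff_card.1 hN
    have hdvd : p ∣ Nat.card N := by
      rw [hk]
      refine dvd_pow_self p fun h0 => ?_
      rw [h0, pow_zero] at hk
      exact (Finite.one_lt_card (α := N)).ne' hk
    obtain ⟨n, hn⟩ := exists_prime_orderOf_dvd_card' p hdvd
    intro h
    have hmem : (n : B) ∈ T := ⟨n.2, by rw [← Subgroup.coe_pow, ← hn, pow_orderOf_eq_one]; rfl⟩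
    rw [h, Subgroup.mem_bot, OneMemClass.coe_eq_one] at hmem
    rw [hmem, orderOf_one] at hn
    exact hp.out.one_lt.ne hn
  exact Subtype.ext (hmin T hT (fun _ h => h.1) hT0 x.2).2

end MinimalNormal

/-! ### Embedding problems with `p`-group kernel -/

section Lifting

open IntermediateField

variable {p : ℕ} [hp : Fact p.Prime] {K F : Type*} [Field K] [Field F] [Algebra K F]
  [IsGalois K F] [CharP F p] [Algebra (ZMod p) F] [IsSepClosed F]

/-- If the kernel is minimal normal in `B` and isomorphic to a vector space `M` over the prime field,
a solution is a cochain that splits the factor set of `B` over `A`. Its image meets the kernel in a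
normal subgroup of `B`, so the solution is surjective as soon as it is non-trivial on `ker α`. -/
theorem exists_surjective_lift_of_elementary_ker
    {A B : Type*} [Group A] [Group B] [Finite A] {α : (F ≃ₐ[K] F) →* A}
    (hα : Function.Surjective α) (hopen : IsOpen (α.ker : Set (F ≃ₐ[K] F)))
    (hline : ∀ c ∈ fixedField α.ker, c ≠ 0 →
      ∃ a : K, ∀ w ∈ fixedField α.ker, artinSchreier p F w ≠ a • c)
    {f : B →* A} (hf : Function.Surjective f)
    {M : Type*} [AddCommGroup M] [Module (ZMod p) M] [Finite M] [Nontrivial M]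
    (e : Multiplicative M ≃* f.ker)
    (hmin : ∀ T : Subgroup B, T.Normal → T ≤ f.ker → T ≠ ⊥ → f.ker ≤ T) :
    ∃ β : (F ≃ₐ[K] F) →* B, f.comp β = α ∧ Function.Surjective β ∧
      IsOpen (β.ker : Set (F ≃ₐ[K] F)) := by
  have hcomm (x y : f.ker) : x * y = y * x := by
    rw [← e.apply_symm_apply x, ← e.apply_symm_apply y, ← map_mul, mul_comm, map_mul]
  -- Conjugation on the commutative group `f.ker` factors through `f`.
  have hconj {b b' : B} (h : f b = f b') {n : B} (hn : n ∈ f.ker) :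
      b * n * b⁻¹ = b' * n * b'⁻¹ := by
    have hmem : b'⁻¹ * b ∈ f.ker := by simp [MonoidHom.mem_ker, h]
    have hc : b'⁻¹ * b * n = n * (b'⁻¹ * b) := congrArg Subtype.val (hcomm ⟨_, hmem⟩ ⟨n, hn⟩)
    calc b * n * b⁻¹ = b' * (b'⁻¹ * b * n) * b⁻¹ := by group
      _ = b' * n * b'⁻¹ := by rw [hc]; group
  let s := Function.surjInv hf
  have hs : ∀ σ, f (s σ) = σ := Function.surjInv_eq hf
  let i (m : M) : B := e (Multiplicative.ofAdd m)
  have hi (m : M) : i m ∈ f.ker := (e (Multiplicative.ofAdd m)).2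
  have hext {m m' : M} (h : i m = i m') : m = m' :=
    Multiplicative.ofAdd.injective (e.injective (Subtype.ext h))
  have hadd (m m' : M) : i (m + m') = i m * i m' := by
    simp only [i, ofAdd_add, map_mul, Subgroup.coe_mul]
  let act (b : B) : M →ₗ[ZMod p] M :=
    (AddMonoidHom.toMultiplicative.symm
      ((e.trans (MulAut.conjNormal b)).trans e.symm).toMonoidHom).toZModLinearMap p
  have hact (b : B) (m : M) : i (act b m) = b * i m * b⁻¹ := by
    have : i (act b m) = e (e.symm (MulAut.conjNormal b (e (Multiplicative.ofAdd m)))) := rfl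
    rw [this, e.apply_symm_apply]
    exact MulAut.conjNormal_apply b _
  let ρ : Representation (ZMod p) A M :=
    { toFun := fun σ => act (s σ)
      map_one' := LinearMap.ext fun m => hext (by
        rw [hact, hconj (b' := 1) (by rw [hs, map_one]) (hi m)]
        simp)
      map_mul' := fun σ τ => LinearMap.ext fun m => hext (by
        rw [hact, hconj (b' := s σ * s τ) (by simp [hs]) (hi m), Module.End.mul_apply, hact,
          hact]
        group) }
  have hρ (σ : A) (m : M) : i (ρ σ m) = s σ * i m * (s σ)⁻¹ := hact _ _
  let κ (σ τ : A) : M :=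
    (e.symm ⟨s σ * s τ * (s (σ * τ))⁻¹, by simp [MonoidHom.mem_ker, hs]⟩).toAdd
  have hκ (σ τ : A) : i (κ σ τ) = s σ * s τ * (s (σ * τ))⁻¹ := by
    simp [i, κ]
  obtain ⟨b, hb, ⟨g₀, hg₀, hbg₀⟩, U, hU, hbU⟩ :=
    exists_cochain_splitting hα hopen hline ρ κ fun σ τ υ => hext (by
      rw [hadd, hadd, hρ, hκ, hκ, hκ, hκ, mul_assoc σ]
      group)
  let β : (F ≃ₐ[K] F) →* B := MonoidHom.mk' (fun g => i (b g) * s (α g)) fun g h => by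
    rw [hb, map_mul, hadd, hadd, hρ, hκ]
    group
  have hβ (g) : β g = i (b g) * s (α g) := rfl
  have hfβ (g) : f (β g) = α g := by
    rw [hβ, map_mul, hs, MonoidHom.mem_ker.1 (hi _), one_mul]
  have hβ1 {g} (hg : g ∈ α.ker) : β g = 1 ↔ b g = b 1 := by
    rw [← map_one β, hβ, hβ, map_one, MonoidHom.mem_ker.1 hg, mul_left_inj]
    exact ⟨hext, fun h => by rw [h]⟩
  refine ⟨β, MonoidHom.ext hfβ, ?_, ?_⟩
  · have hle : f.ker ≤ β.range ⊓ f.ker := by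
      refine hmin _ ⟨fun n hn x => ⟨?_, ?_⟩⟩ inf_le_right fun h => ?_
      · obtain ⟨g, hg⟩ := hα (f x)
        rw [hconj (b' := β g) (by rw [hfβ, hg]) hn.2]
        exact β.range.mul_mem (β.range.mul_mem ⟨g, rfl⟩ hn.1) (β.range.inv_mem ⟨g, rfl⟩)
      · exact Subgroup.Normal.conj_mem inferInstance n hn.2 x
      · have hmem : β g₀ ∈ β.range ⊓ f.ker := ⟨⟨g₀, rfl⟩, (hfβ g₀).trans hg₀⟩
        rw [h, Subgroup.mem_bot, hβ1 hg₀] at hmem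
        exact hbg₀ hmem
    intro x
    obtain ⟨g, hg⟩ := hα (f x)
    obtain ⟨h, hh⟩ := (hle (x := x * (β g)⁻¹) (by simp [MonoidHom.mem_ker, hfβ, hg])).1
    exact ⟨h * g, by rw [map_mul, hh, inv_mul_cancel_right]⟩
  · refine Subgroup.isOpen_mono (H₁ := α.ker ⊓ U) (fun g hg => ?_) (hopen.inter hU)
    exact (hβ1 hg.1).2 (hbU g hg.2)

/-- A minimal normal kernel that is a `p`-group is an elementary abelian `p`-group. -/
theorem exists_surjective_lift_of_minimal_ker
    {A B : Type*} [Group A] [Group B] [Finite A] [Finite B] {α : (F ≃ₐ[K] F) →* A}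
    (hα : Function.Surjective α) (hopen : IsOpen (α.ker : Set (F ≃ₐ[K] F)))
    (hline : ∀ c ∈ fixedField α.ker, c ≠ 0 →
      ∃ a : K, ∀ w ∈ fixedField α.ker, artinSchreier p F w ≠ a • c)
    {f : B →* A} (hf : Function.Surjective f) (hN : IsPGroup p f.ker) (hne : f.ker ≠ ⊥)
    (hmin : ∀ T : Subgroup B, T.Normal → T ≤ f.ker → T ≠ ⊥ → f.ker ≤ T) :
    ∃ β : (F ≃ₐ[K] F) →* B, f.comp β = α ∧ Function.Surjective β ∧
      IsOpen (β.ker : Set (F ≃ₐ[K] F)) := by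
  let _ : CommGroup f.ker :=
    { (inferInstance : Group f.ker) with mul_comm := mul_comm_of_minimal_normal hN hne hmin }
  let _ : Module (ZMod p) (Additive f.ker) := AddCommGroup.zmodModule fun x =>
    congrArg Additive.ofMul (pow_eq_one_of_minimal_normal hN hne hmin x.toMul)
  have : Nontrivial (Additive f.ker) := (Subgroup.nontrivial_iff_ne_bot f.ker).2 hne
  have : Finite (Additive f.ker) := inferInstanceAs (Finite f.ker)
  exact exists_surjective_lift_of_elementary_ker (M := Additive f.ker) hα hopen hline hf
    (MulEquiv.multiplicativeAdditive f.ker) hmin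

/-- An embedding problem whose kernel is a `p`-group is solved by successive steps with minimal
normal kernel. -/
theorem exists_surjective_lift
    (hline : ∀ V : Subgroup (F ≃ₐ[K] F), IsOpen (V : Set (F ≃ₐ[K] F)) →
      ∀ c ∈ fixedField V, c ≠ 0 →
        ∃ a : K, ∀ w ∈ fixedField V, artinSchreier p F w ≠ a • c)
    {A : Type w} [Group A] [Finite A] {α : (F ≃ₐ[K] F) →* A} (hα : Function.Surjective α)
    (hopen : IsOpen (α.ker : Set (F ≃ₐ[K] F)))
    {B : Type v} [Group B] [Finite B]
    {f : B →* A} (hf : Function.Surjective f) (hN : IsPGroup p f.ker) :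
    ∃ β : (F ≃ₐ[K] F) →* B, f.comp β = α ∧ Function.Surjective β ∧
      IsOpen (β.ker : Set (F ≃ₐ[K] F)) := by
  induction hn : Nat.card B using Nat.strong_induction_on generalizing B with
  | _ n ih =>
    by_cases hbot : f.ker = ⊥
    · let e := MulEquiv.ofBijective f ⟨(MonoidHom.ker_eq_bot_iff f).1 hbot, hf⟩
      refine ⟨e.symm.toMonoidHom.comp α, MonoidHom.ext fun g => e.apply_symm_apply (α g),
        e.symm.surjective.comp hα, ?_⟩
      exact (MonoidHom.ker_mulEquiv_comp α e.symm).symm ▸ hopen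
    · obtain ⟨N, ⟨hNn, hNle, hNbot⟩, hNmin⟩ :=
        (Set.toFinite {T : Subgroup B | T.Normal ∧ T ≤ f.ker ∧ T ≠ ⊥}).exists_minimal
          ⟨f.ker, inferInstance, le_rfl, hbot⟩
      let f' : B ⧸ N →* A := QuotientGroup.lift N f hNle
      have hcard : Nat.card (B ⧸ N) < n := by
        rw [← hn, N.card_eq_card_quotient_mul_card_subgroup]
        exact lt_mul_of_one_lt_right Nat.card_pos (N.one_lt_card_iff_ne_bot.2 hNbot)
      have hf' : Function.Surjective f' := fun a => by
        obtain ⟨x, rfl⟩ := hf a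
        exact ⟨x, rfl⟩
      have hN' : IsPGroup p f'.ker := by
        rintro ⟨x, hx⟩
        obtain ⟨x, rfl⟩ := QuotientGroup.mk_surjective x
        obtain ⟨k, hk⟩ := hN ⟨x, hx⟩
        exact ⟨k, Subtype.ext (congrArg (QuotientGroup.mk' N) (congrArg Subtype.val hk))⟩
      obtain ⟨β', hβ', hsurj, hopen'⟩ := ih _ hcard hf' hN' rfl
      have hker : (QuotientGroup.mk' N).ker = N := QuotientGroup.ker_mk' N
      obtain ⟨β, hβ, hβs, hβo⟩ := exists_surjective_lift_of_minimal_ker hsurj hopen'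
        (hline _ hopen') (QuotientGroup.mk'_surjective N)
        (by rw [hker]; exact hN.to_le hNle) (by rwa [hker])
        (fun T hT hle hT0 => by
          rw [hker] at hle ⊢
          exact hNmin ⟨hT, hle.trans hNle, hT0⟩ hle)
      refine ⟨β, ?_, hβs, hβo⟩
      rw [← hβ', ← hβ]
      rfl

end Lifting

/-! ### Valued fields -/

/-- For a field with a valuation whose value group is not `p`-divisible, the Artin–Schreier images
of finite separable extensions contain no line over the base field. -/
lemma exists_forall_mem_fixedField_artinSchreier_ne {p : ℕ} [hp : Fact p.Prime] {K F : Type*}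
    [Field K] [Field F] [Algebra K F] [IsGalois K F] [CharP K p] [CharP F p] [Algebra (ZMod p) F]
    {Γ : Type*} [AddCommGroup Γ] [LinearOrder Γ] [IsOrderedAddMonoid Γ]
    (val : AddValuation K (WithTop Γ)) (hval : Function.Surjective val) (hΓ : ¬ IsPDivisible p Γ)
    (V : Subgroup (F ≃ₐ[K] F)) (hV : IsOpen (V : Set (F ≃ₐ[K] F)))
    (c : F) (hcV : c ∈ IntermediateField.fixedField V) (hc : c ≠ 0) :
    ∃ a : K, ∀ w ∈ IntermediateField.fixedField V, artinSchreier p F w ≠ a • c := by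
  have hfix : (IntermediateField.fixedField V).fixingSubgroup = V :=
    InfiniteGalois.fixingSubgroup_fixedField ⟨V, Subgroup.isClosed_of_isOpen _ hV⟩
  have : FiniteDimensional K (IntermediateField.fixedField V) := by
    rw [← InfiniteGalois.isOpen_iff_finite, hfix]
    exact hV
  obtain ⟨a, ha⟩ := exists_forall_pow_sub_ne_smul val hval hΓ
    (c := (⟨c, hcV⟩ : IntermediateField.fixedField V)) (fun h => hc (congrArg Subtype.val h))
  exact ⟨a, fun w hw h => ha ⟨w, hw⟩ (Subtype.ext h)⟩

theorem theorem1p1 (p : ℕ) [Fact p.Prime] (K : Type u) [Field K] [CharP K p]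
    (Γ : Type x) [AddCommGroup Γ] [LinearOrder Γ] [IsOrderedAddMonoid Γ]
    (val : AddValuation K (WithTop Γ)) (hval : Function.Surjective val)
    (hΓ : ¬ IsPDivisible p Γ)
    (E : EmbeddingProblem.{u, v, w} (AbsGal K))
    (hfin : E.IsFinite) (hp : E.IsPEmbeddingProblem p) :
    E.IsProperlySolvable := by
  have : Finite E.B := hfin
  have : Finite E.A := Finite.of_surjective E.f E.surjective_f
  have : CharP (SeparableClosure K) p :=
    charP_of_injective_algebraMap (algebraMap K (SeparableClosure K)).injective p
  let _ : Algebra (ZMod p) (SeparableClosure K) := ZMod.algebra _ p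
  have hopen : IsOpen (E.α.toMonoidHom.ker : Set (AbsGal K)) :=
    (isOpen_discrete ({1} : Set E.A)).preimage E.α.continuous_toFun
  obtain ⟨β, hβ, hsurj, hβo⟩ := exists_surjective_lift (p := p)
    (exists_forall_mem_fixedField_artinSchreier_ne val hval hΓ)
    (α := E.α.toMonoidHom) E.surjective_α hopen (f := E.f.toMonoidHom) E.surjective_f hp
  have hcont : Continuous β := by
    refine continuous_of_continuousAt_one β ?_
    rw [ContinuousAt, map_one, nhds_discrete E.B, Filter.tendsto_pure]
    exact hβo.mem_nhds (one_mem β.ker)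
  exact ⟨⟨β, hcont⟩, ContinuousMonoidHom.ext fun g => DFunLike.congr_fun hβ g, hsurj⟩
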